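/- Let $F$ be the distribution function of a nonnegative random variable $W$ with $\nu:=\mathbb{E}[W^2]/\mathbb{E}[W]=1$. Assume that either (i) $\tau>4$ and there is $c_F>0$ such that $1-F(x)\le c_F x^{-(\tau-1)}$ for all sufficiently large $x$, or (ii) $\tau\in(3,4)$ and $\lim_{x\to\infty}x^{\tau-1}[1-F(x)]=c_F$ for some $0<c_F<\infty$. Put $\delta=\min\{\tau,4\}-2$. For $n\ge 1$ and $1\le j\le n$ let $w_j=[1-F]^{-1}(j/n)$, where $[1-F]^{-1}(u)=\inf\{s:1-F(s)\le u\}$ for $u\in(0,1)$ and $[1-F]^{-1}(1)=0$. For $\varepsilon_n\ge -1$ let $\tilde w_j=(1+\varepsilon_n)w_j$ and $\tilde\ell_n=\sum_{j=1}^n\tilde w_j$, and consider the Norros–Reittu random graph ${\rm NR}_n(\tilde{\boldsymbol w})$ on $[n]=\{1,\dots,n\}$, in which the edges $ij$, $1\le i<j\le n$, are present independently with probabilities $1-\mathrm{e}^{-\tilde w_i\tilde w_j/\tilde\ell_n}$ (equal to $0$ if $\tilde\ell_n=0$). Let $\mathcal{C}(v)$ be the connected component of $v$ in this graph, and let $V_n$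 be a uniformly chosen vertex in $[n]$, independent of the graph. Then there is $\Lambda_0\ge 1$, depending only on $F$ and $\tau$, such that for all $\Lambda\ge\Lambda_0$, all $n\ge 1$ and all $\varepsilon_n$ with $-1\le\varepsilon_n\le-\Lambda n^{-(\delta-1)/(\delta+1)}$, $$\mathbb{E}\big[|\mathcal{C}(V_n)|\big]\le n^{(\delta-1)/(\delta+1)}.$$ -/

import Mathlib

open MeasureTheory ProbabilityTheory Filter Topology

noncomputable section

namespace NorrosReittu

/-- The generalized inverse `[1-F]⁻¹(u) = inf {s : 1 - F(s) ≤ u}` for `u ∈ (0,1)`, with the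
convention `[1-F]⁻¹(1) = 0`. -/
def tailInv (F : ℝ → ℝ) (u : ℝ) : ℝ :=
  if u = 1 then 0 else sInf {s : ℝ | 1 - F s ≤ u}

/-- The vertex weights `w_j = [1-F]⁻¹(j/n)`, `j = 1, …, n`. Vertex `j` is the element `j - 1`
of `Fin n`. -/
def weight (F : ℝ → ℝ) (n : ℕ) (i : Fin n) : ℝ :=
  tailInv F (((i : ℕ) + 1 : ℝ) / (n : ℝ))

/-- The rescaled weights `(1+ε) w_j`. -/
def scaledWeight (F : ℝ → ℝ) (ε : ℝ) (n : ℕ) (i : Fin n) : ℝ :=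
  (1 + ε) * weight F n i

/-- The ratio `ν = E[W²] / E[W]`, where `W` has law `μ`. -/
def nu (μ : Measure ℝ) : ℝ := (∫ x, x ^ 2 ∂μ) / (∫ x, x ∂μ)

/-- The pairs `i < j` of vertices, i.e. the potential edges. -/
abbrev Pair (n : ℕ) : Type := {e : Fin n × Fin n // e.1 < e.2}

/-- Edge configurations: `true` means that the edge is occupied. -/
abbrev Config (n : ℕ) : Type := Pair n → Bool

/-- The edge probability `1 - exp (-(w_i w_j / ℓ_n))`, where `ℓ_n = ∑ k, w_k`. It is `0` if all
weights vanish. -/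
def edgeProb {n : ℕ} (w : Fin n → ℝ) (i j : Fin n) : ℝ :=
  1 - Real.exp (-(w i * w j / ∑ k, w k))

/-- The law of the edge configuration of the Norros-Reittu random graph with weights `w`: the
edges are independent, and the edge between `i < j` is occupied with probability `edgeProb w i j`.
For nonnegative weights this number lies in `[0,1]`, and the projection to `[0,1]` is the
identity. -/
def law {n : ℕ} (w : Fin n → ℝ) : Measure (Config n) :=
  Measure.pi fun e : Pair n =>
    bernoulliMeasure true false
      (Set.projIcc (0 : ℝ) 1 zero_le_one (edgeProb w e.1.1 e.1.2))

/-- The graph of occupied edges. -/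
def graph {n : ℕ} (ω : Config n) : SimpleGraph (Fin n) :=
  SimpleGraph.fromRel fun i j => ∃ h : i < j, ω ⟨(i, j), h⟩ = true

/-- The cluster of `v`: all vertices connected to `v` by a path of edges (including `v`). -/
def cluster {n : ℕ} (G : SimpleGraph (Fin n)) (v : Fin n) : Set (Fin n) :=
  {x | G.Reachable v x}

/-- The expected size `E|C(V_n)|` of the cluster of `V_n` in the Norros-Reittu random graph with
weights `w`, where `V_n` is uniform on the vertex set and independent of the graph. -/
def expectedClusterSize {n : ℕ} (w : Fin n → ℝ) : ℝ :=
  ∫ x : Config n × Fin n, ((cluster (graph x.1) x.2).ncard : ℝ)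
    ∂((law w).prod (uniformOn (Set.univ : Set (Fin n))))

end NorrosReittu

end

/-! ### Self-avoiding exploration of a cluster -/

namespace NorrosReittu

variable {n : ℕ}

/-! Self-avoiding paths are dominated by a branching process. The first edge of such a path is
independent of its continuation, and an edge `ij` has probability at most `w i * w j / ∑ k, w k`. If
`∑ w² ≤ ρ ∑ w` with `ρ < 1`, the expected cluster of `v` is therefore at most `1 + w v / (1 - ρ)`;
averaging over `v` gives `expectedClusterSize_le`.

It remains to find `ρ`. The weights are values of the quantile function at `j/n`, so sums over them
are Riemann sums of a monotone function. With `m = E[W] = E[W²]`, the second moment of the weights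
is at most `m`, and their mean lies between `m - O(n^(-1/2))` and `m`. Since `(δ-1)/(δ+1) ≤ 1/2`,
this error is absorbed by `Λ n^(-(δ-1)/(δ+1))` once `Λ` is large, and `1 - ρ` is of that same order.
-/

/-- The vertices reachable from `v` along paths that stay in `S` after their first vertex. -/
def clusterThrough (G : SimpleGraph (Fin n)) (S : Finset (Fin n)) (v : Fin n) : Set (Fin n) :=
  {x | Relation.ReflTransGen (fun a b => b ∈ S ∧ G.Adj a b) v x}

lemma mem_clusterThrough {G : SimpleGraph (Fin n)} {S : Finset (Fin n)} {v x : Fin n} :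
    x ∈ clusterThrough G S v ↔ Relation.ReflTransGen (fun a b => b ∈ S ∧ G.Adj a b) v x :=
  Iff.rfl

/-- Loop erasure: whenever a path returns to `v`, it can be restarted there. -/
lemma clusterThrough_subset_erase (G : SimpleGraph (Fin n)) (S : Finset (Fin n)) (v : Fin n) :
    clusterThrough G S v ⊆ clusterThrough G (S.erase v) v := by
  intro x hx
  rw [mem_clusterThrough] at hx ⊢
  induction hx with
  | refl => exact .refl
  | @tail b c _ hbc ih =>
    rcases eq_or_ne c v with rfl | hc
    · exact .refl
    · exact ih.tail ⟨Finset.mem_erase.2 ⟨hc, hbc.1⟩, hbc.2⟩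

lemma cluster_subset_clusterThrough (G : SimpleGraph (Fin n)) (v : Fin n) :
    cluster G v ⊆ clusterThrough G (Finset.univ.erase v) v := by
  refine Set.Subset.trans ?_ (clusterThrough_subset_erase G Finset.univ v)
  intro x hx
  have hx : G.Reachable v x := hx
  rw [SimpleGraph.reachable_iff_reflTransGen] at hx
  exact hx.lift id fun a b h => ⟨Finset.mem_univ b, h⟩

lemma clusterThrough_subset_iUnion (G : SimpleGraph (Fin n)) (S : Finset (Fin n)) (v : Fin n) :
    clusterThrough G S v ⊆
      {v} ∪ ⋃ y ∈ S, {x | G.Adj v y ∧ x ∈ clusterThrough G (S.erase y) y} := by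
  intro x hx
  rw [mem_clusterThrough] at hx
  rcases hx.cases_head with rfl | ⟨y, ⟨hyS, hvy⟩, hyx⟩
  · simp
  · refine Or.inr (Set.mem_iUnion₂.2 ⟨y, hyS, hvy, clusterThrough_subset_erase G S y hyx⟩)

open Classical in
lemma ncard_clusterThrough_le (G : SimpleGraph (Fin n)) (S : Finset (Fin n)) (v : Fin n) :
    ((clusterThrough G S v).ncard : ℝ) ≤
      1 + ∑ y ∈ S, if G.Adj v y then ((clusterThrough G (S.erase y) y).ncard : ℝ) else 0 := by
  have h1 : (clusterThrough G S v).ncard ≤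
      1 + ∑ y ∈ S, if G.Adj v y then (clusterThrough G (S.erase y) y).ncard else 0 := by
    calc (clusterThrough G S v).ncard
        ≤ ({v} ∪ ⋃ y ∈ S, {x | G.Adj v y ∧ x ∈ clusterThrough G (S.erase y) y}).ncard :=
          Set.ncard_le_ncard (clusterThrough_subset_iUnion G S v) (Set.toFinite _)
      _ ≤ _ := Set.ncard_union_le _ _
      _ ≤ _ := by
          rw [Set.ncard_singleton]
          refine Nat.add_le_add_left ((Finset.set_ncard_biUnion_le _ _).trans ?_) 1
          refine Finset.sum_le_sum fun y _ => ?_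
          split_ifs with h <;> simp [h]
  exact_mod_cast h1

/-! ### Independence of the edges -/

/-- The potential edge between two distinct vertices. -/
def edgeOf {v y : Fin n} (h : v ≠ y) : Pair n := ⟨(min v y, max v y), min_lt_max.2 h⟩

lemma graph_adj (ω : Config n) {v y : Fin n} (h : v ≠ y) :
    (graph ω).Adj v y ↔ ω (edgeOf h) = true := by
  rw [graph, SimpleGraph.fromRel_adj]
  rcases lt_or_gt_of_ne h with hlt | hlt
  · simp [edgeOf, h, hlt, hlt.le, hlt.not_gt]
  · simp [edgeOf, h, hlt, hlt.le, hlt.not_gt]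

lemma clusterThrough_subset_of_eqOn {ω ω' : Config n} {S : Finset (Fin n)} {v : Fin n}
    (h : ∀ e : Pair n, e.1.1 ∈ insert v S → e.1.2 ∈ insert v S → ω e = ω' e) :
    clusterThrough (graph ω) S v ⊆ clusterThrough (graph ω') S v := by
  intro x hx
  rw [mem_clusterThrough] at hx
  suffices x ∈ insert v S ∧ x ∈ clusterThrough (graph ω') S v from this.2
  induction hx with
  | refl => exact ⟨Finset.mem_insert_self _ _, .refl⟩
  | @tail b c _ hbc ih =>
    have hc : c ∈ insert v S := Finset.mem_insert_of_mem hbc.1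
    refine ⟨hc, Relation.ReflTransGen.tail ih.2 ⟨hbc.1, ?_⟩⟩
    have hne : b ≠ c := hbc.2.ne
    rw [graph_adj _ hne, ← h, ← graph_adj _ hne]
    · exact hbc.2
    · rcases min_choice b c with h | h <;> simp only [edgeOf, h, hc, ih.1]
    · rcases max_choice b c with h | h <;> simp only [edgeOf, h, hc, ih.1]

instance (w : Fin n → ℝ) : IsProbabilityMeasure (law w) := by
  unfold law; infer_instance

lemma integral_law_eval {w : Fin n → ℝ} {e : Pair n} (h0 : 0 ≤ edgeProb w e.1.1 e.1.2)
    (h1 : edgeProb w e.1.1 e.1.2 ≤ 1) :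
    ∫ ω, (if ω e = true then (1 : ℝ) else 0) ∂(law w) = edgeProb w e.1.1 e.1.2 := by
  have hmp := measurePreserving_eval (fun e : Pair n => bernoulliMeasure true false
      (Set.projIcc (0 : ℝ) 1 zero_le_one (edgeProb w e.1.1 e.1.2))) e
  have := integral_map (μ := law w) (φ := Function.eval e) hmp.measurable.aemeasurable
    (f := fun b : Bool => if b = true then (1 : ℝ) else 0)
    (Measurable.of_discrete).aestronglyMeasurable
  have h2 : (law w).map (Function.eval e) = _ := hmp.map_eq
  rw [h2] at this
  simp only [Function.eval] at this
  rw [← this, integral_bernoulliMeasure, Set.projIcc_of_mem zero_le_one ⟨h0, h1⟩]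
  simp

lemma integral_ite_edge {w : Fin n → ℝ} {e : Pair n} (h0 : 0 ≤ edgeProb w e.1.1 e.1.2)
    (h1 : edgeProb w e.1.1 e.1.2 ≤ 1) {f : Config n → ℝ}
    (hf : ∀ ω ω', (∀ e', e' ≠ e → ω e' = ω' e') → f ω = f ω') :
    ∫ ω, (if ω e = true then f ω else 0) ∂(law w) =
      edgeProb w e.1.1 e.1.2 * ∫ ω, f ω ∂(law w) := by
  classical
  have hind : iIndepFun (fun (e : Pair n) (ω : Config n) => ω e) (law w) :=
    iIndepFun_pi (X := fun _ b => b) fun _ => aemeasurable_id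
  have hfin := hind.indepFun_finset {e} (Finset.univ.erase e)
    (Finset.disjoint_singleton_left.2 (Finset.notMem_erase _ _)) fun _ => measurable_pi_apply _
  have hcomp := hfin.comp
    (φ := fun r => if r ⟨e, Finset.mem_singleton_self e⟩ = true then (1 : ℝ) else 0)
    -- `f` ignores the coordinate `e`, so filling it with `false` exhibits `f` as a function of the
    -- other edges.
    (ψ := fun r => f fun e' => if h : e' ∈ Finset.univ.erase e then r ⟨e', h⟩ else false)
    Measurable.of_discrete Measurable.of_discrete
  have hint := hcomp.integral_fun_mul_eq_mul_integral
    (Measurable.of_discrete).aestronglyMeasurable (Measurable.of_discrete).aestronglyMeasurable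
  have hψ : ∀ ω : Config n,
      f (fun e' => if h : e' ∈ Finset.univ.erase e then ω e' else false) = f ω := by
    intro ω
    refine hf _ _ fun e' he' => ?_
    simp [he']
  simp only [Function.comp_apply, hψ] at hint
  rw [integral_law_eval h0 h1] at hint
  rw [← hint]
  congr 1 with ω
  simp

lemma edgeProb_nonneg {w : Fin n → ℝ} (hw : ∀ i, 0 ≤ w i) (i j : Fin n) : 0 ≤ edgeProb w i j := by
  have : 0 ≤ w i * w j / ∑ k, w k :=
    div_nonneg (mul_nonneg (hw i) (hw j)) (Finset.sum_nonneg fun k _ => hw k)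
  simpa [edgeProb] using this

lemma edgeProb_le_one (w : Fin n → ℝ) (i j : Fin n) : edgeProb w i j ≤ 1 := by
  simpa [edgeProb] using (Real.exp_pos _).le

lemma edgeProb_le (w : Fin n → ℝ) (i j : Fin n) : edgeProb w i j ≤ w i * w j / ∑ k, w k := by
  have := Real.add_one_le_exp (-(w i * w j / ∑ k, w k))
  unfold edgeProb
  linarith

lemma edgeProb_edgeOf (w : Fin n → ℝ) {v y : Fin n} (h : v ≠ y) :
    edgeProb w (edgeOf h).1.1 (edgeOf h).1.2 = edgeProb w v y := by
  rcases lt_or_gt_of_ne h with hlt | hlt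
  · simp [edgeOf, min_eq_left hlt.le, max_eq_right hlt.le]
  · simp [edgeOf, min_eq_right hlt.le, max_eq_left hlt.le, edgeProb, mul_comm]

/-! ### Subcritical bound on the expected cluster size -/

open Classical in
/-- A first-step inequality: the first edge of a path is independent of the rest of it. -/
lemma integral_ncard_clusterThrough_le {w : Fin n → ℝ} (hw : ∀ i, 0 ≤ w i)
    {S : Finset (Fin n)} {v : Fin n} (hv : v ∉ S) :
    ∫ ω, ((clusterThrough (graph ω) S v).ncard : ℝ) ∂(law w) ≤
      1 + ∑ y ∈ S, edgeProb w v y *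
        ∫ ω, ((clusterThrough (graph ω) (S.erase y) y).ncard : ℝ) ∂(law w) := by
  calc ∫ ω, ((clusterThrough (graph ω) S v).ncard : ℝ) ∂(law w)
      ≤ ∫ ω, (1 + ∑ y ∈ S, if (graph ω).Adj v y then
          ((clusterThrough (graph ω) (S.erase y) y).ncard : ℝ) else 0) ∂(law w) :=
        integral_mono .of_finite .of_finite fun ω => ncard_clusterThrough_le _ _ _
    _ = 1 + ∑ y ∈ S, ∫ ω, (if (graph ω).Adj v y then
          ((clusterThrough (graph ω) (S.erase y) y).ncard : ℝ) else 0) ∂(law w) := by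
        rw [integral_add .of_finite .of_finite, integral_finsetSum _ fun _ _ => .of_finite]
        simp
    _ = _ := by
        congr 1
        refine Finset.sum_congr rfl fun y hy => ?_
        have hvy : v ≠ y := fun h => hv (h ▸ hy)
        simp only [graph_adj _ hvy]
        rw [← edgeProb_edgeOf w hvy]
        refine integral_ite_edge (edgeProb_nonneg hw _ _) (edgeProb_le_one _ _ _) ?_
        -- The continuation from `y` uses only edges with both ends in `S`; the edge `vy` is not one
        -- of them, as `v ∉ S`.
        have hS : insert y (S.erase y) = S := Finset.insert_erase hy
        intro ω ω' h
        have key : ∀ e' : Pair n, e'.1.1 ∈ insert y (S.erase y) → e'.1.2 ∈ insert y (S.erase y) →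
            ω e' = ω' e' := by
          intro e' h1 h2
          rw [hS] at h1 h2
          refine h e' ?_
          rintro rfl
          rcases min_choice v y with hm | hm
          · exact hv (by simpa only [edgeOf, hm] using h1)
          · rw [min_eq_right_iff] at hm
            exact hv (by simpa only [edgeOf, max_eq_left hm] using h2)
        rw [Set.Subset.antisymm (clusterThrough_subset_of_eqOn key)
          (clusterThrough_subset_of_eqOn fun e' h1 h2 => (key e' h1 h2).symm)]

/-- The bound reproduces itself under the first-step inequality because `1 + ρ / (1 - ρ) = 1 / (1 -
ρ)`; the induction ends because each step removes a vertex from `S`. -/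
lemma integral_ncard_clusterThrough_le_of_subcritical {w : Fin n → ℝ} (hw : ∀ i, 0 ≤ w i)
    {ρ : ℝ} (hρ : ρ < 1) (hwρ : ∑ i, w i ^ 2 ≤ ρ * ∑ i, w i) (S : Finset (Fin n)) :
    ∀ v ∉ S, ∫ ω, ((clusterThrough (graph ω) S v).ncard : ℝ) ∂(law w) ≤ 1 + w v / (1 - ρ) := by
  induction S using Finset.strongInduction with
  | H S ih =>
    intro v hv
    have hρ' : 0 < 1 - ρ := by linarith
    have hℓ : 0 ≤ ∑ k, w k := Finset.sum_nonneg fun k _ => hw k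
    calc _ ≤ _ := integral_ncard_clusterThrough_le hw hv
      _ ≤ 1 + ∑ y ∈ S, w v * w y / (∑ k, w k) * (1 + w y / (1 - ρ)) := by
          gcongr with y hy
          · exact div_nonneg (mul_nonneg (hw v) (hw y)) hℓ
          · exact edgeProb_le w v y
          · exact ih _ (Finset.erase_ssubset hy) y (Finset.notMem_erase y S)
      _ ≤ 1 + ∑ y, w v * w y / (∑ k, w k) * (1 + w y / (1 - ρ)) := by
          refine add_le_add_right ?_ 1
          refine Finset.sum_le_sum_of_subset_of_nonneg (Finset.subset_univ S) fun y _ _ => ?_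
          have := div_nonneg (hw y) hρ'.le
          have := div_nonneg (mul_nonneg (hw v) (hw y)) hℓ
          positivity
      _ = 1 + w v / (∑ k, w k) * (∑ y, w y + (∑ y, w y ^ 2) / (1 - ρ)) := by
          rw [Finset.sum_div, ← Finset.sum_add_distrib, Finset.mul_sum]
          congr 1
          refine Finset.sum_congr rfl fun y _ => ?_
          ring
      _ ≤ 1 + w v / (∑ k, w k) * ((∑ y, w y) / (1 - ρ)) := by
          have h1 : ∑ y, w y + (∑ y, w y ^ 2) / (1 - ρ) ≤ (∑ y, w y) / (1 - ρ) := by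
            rw [le_div_iff₀ hρ', add_mul, div_mul_cancel₀ _ hρ'.ne']
            linarith
          have := div_nonneg (hw v) hℓ
          gcongr
      _ ≤ 1 + w v / (1 - ρ) := by
          rcases hℓ.eq_or_lt with h | h
          · rw [← h]
            simpa using div_nonneg (hw v) hρ'.le
          · rw [div_mul_div_comm, mul_comm (w v), mul_div_mul_left _ _ h.ne']

lemma integral_uniformOn_univ (f : Fin n → ℝ) :
    ∫ v, f v ∂(uniformOn (Set.univ : Set (Fin n))) = (∑ v, f v) / n := by
  rw [uniformOn, ProbabilityTheory.cond, Measure.restrict_univ, integral_smul_measure, integral_count]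
  simp [div_eq_inv_mul]

theorem expectedClusterSize_le {w : Fin n → ℝ} (hn : 1 ≤ n) (hw : ∀ i, 0 ≤ w i)
    {ρ : ℝ} (hρ : ρ < 1) (hwρ : ∑ i, w i ^ 2 ≤ ρ * ∑ i, w i) :
    expectedClusterSize w ≤ 1 + (∑ i, w i) / n / (1 - ρ) := by
  have : NeZero n := ⟨by omega⟩
  have : IsProbabilityMeasure (uniformOn (Set.univ : Set (Fin n))) :=
    isProbabilityMeasure_uniformOn Set.finite_univ Set.univ_nonempty
  have hn' : (0 : ℝ) < n := by exact_mod_cast hn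
  rw [expectedClusterSize, integral_prod_symm _ .of_finite, integral_uniformOn_univ,
    div_le_iff₀ hn']
  calc _ ≤ ∑ v, (1 + w v / (1 - ρ)) := by
        refine Finset.sum_le_sum fun v _ => ?_
        refine le_trans ?_ (integral_ncard_clusterThrough_le_of_subcritical hw hρ hwρ
          (Finset.univ.erase v) v (Finset.notMem_erase v _))
        refine integral_mono .of_finite .of_finite fun ω => ?_
        exact Nat.cast_le.2 <| Set.ncard_le_ncard (cluster_subset_clusterThrough (graph ω) v)
          (Set.toFinite _)
    _ = _ := by
        rw [Finset.sum_add_distrib, ← Finset.sum_div]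
        simp
        field_simp

end NorrosReittu

namespace NorrosReittu

/-! ### Quantile transform -/

section Quantile

/-- Right continuity of the distribution function makes the infimum attained. -/
lemma tailInv_le_iff (μ : Measure ℝ) {u : ℝ} (hu : u ∈ Set.Ioo (0 : ℝ) 1) (x : ℝ) :
    tailInv (cdf μ) u ≤ x ↔ 1 - cdf μ x ≤ u := by
  have hbdd : BddBelow {s : ℝ | 1 - cdf μ s ≤ u} := by
    obtain ⟨a, ha⟩ := ((tendsto_cdf_atBot μ).eventually_lt_const (sub_pos.2 hu.2)).exists
    refine ⟨a, fun s hs => ?_⟩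
    by_contra! h
    have := monotone_cdf μ h.le
    simp only [Set.mem_ofPred_eq] at hs
    linarith
  have hne : {s : ℝ | 1 - cdf μ s ≤ u}.Nonempty := by
    obtain ⟨a, ha⟩ := ((tendsto_cdf_atTop μ).eventually_const_lt
      (show 1 - u < 1 by linarith [hu.1])).exists
    exact ⟨a, by simp only [Set.mem_ofPred_eq]; linarith⟩
  rw [tailInv, if_neg hu.2.ne]
  constructor
  · intro h
    have hright : Tendsto (cdf μ) (𝓝[>] x) (𝓝 (cdf μ x)) :=
      ((cdf μ).right_continuous x).mono_left (nhdsWithin_mono _ Set.Ioi_subset_Ici_self)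
    have : 1 - u ≤ cdf μ x := by
      refine ge_of_tendsto hright ?_
      filter_upwards [self_mem_nhdsWithin] with y (hy : x < y)
      obtain ⟨s, hs, hsy⟩ := exists_lt_of_csInf_lt hne (h.trans_lt hy)
      have := monotone_cdf μ hsy.le
      simp only [Set.mem_ofPred_eq] at hs
      linarith
    linarith
  · exact fun h => csInf_le hbdd h

variable (μ : Measure ℝ)

lemma tailInv_antitoneOn : AntitoneOn (tailInv (cdf μ)) (Set.Ioo 0 1) := by
  intro u hu v hv huv
  rw [tailInv_le_iff μ hv]
  exact ((tailInv_le_iff μ hu _).1 le_rfl).trans huv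

lemma aemeasurable_tailInv : AEMeasurable (tailInv (cdf μ)) (volume.restrict (Set.Ioo 0 1)) :=
  aemeasurable_restrict_of_antitoneOn measurableSet_Ioo (tailInv_antitoneOn μ)

variable [IsProbabilityMeasure μ]

lemma tailInv_nonneg (hpos : ∀ᵐ x ∂μ, 0 ≤ x) {u : ℝ} (hu : u ∈ Set.Ioc (0 : ℝ) 1) :
    0 ≤ tailInv (cdf μ) u := by
  rcases hu.2.eq_or_lt with rfl | h1
  · simp [tailInv]
  · by_contra! h
    have h2 := (tailInv_le_iff μ ⟨hu.1, h1⟩ _).1 le_rfl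
    have h3 : cdf μ (tailInv (cdf μ) u) = 0 := by
      rw [cdf_eq_real, measureReal_def]
      have : μ (Set.Iic (tailInv (cdf μ) u)) = 0 := by
        refine measure_mono_null (fun x hx => ?_) hpos
        simp only [Set.mem_Iic] at hx
        simp only [Set.mem_compl_iff, Set.mem_ofPred_eq, not_le]
        exact hx.trans_lt h
      simp [this]
    linarith

/-- Quantile transform: `[1-F]⁻¹(U)` has law `μ` for uniform `U`. -/
lemma map_tailInv : (volume.restrict (Set.Ioo (0 : ℝ) 1)).map (tailInv (cdf μ)) = μ := by
  have hP : IsProbabilityMeasure (volume.restrict (Set.Ioo (0 : ℝ) 1)) := ⟨by simp⟩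
  have hQ := Measure.isProbabilityMeasure_map (aemeasurable_tailInv μ)
  refine Measure.ext_of_Iic _ _ fun x => ?_
  rw [Measure.map_apply_of_aemeasurable (aemeasurable_tailInv μ) measurableSet_Iic,
    Measure.restrict_apply₀' measurableSet_Ioo.nullMeasurableSet]
  have h0 := cdf_nonneg μ x
  have h1 := cdf_le_one μ x
  have : tailInv (cdf μ) ⁻¹' Set.Iic x ∩ Set.Ioo 0 1 =
      Set.Ici (1 - cdf μ x) ∩ Set.Ioo 0 1 := by
    ext u
    simp only [Set.mem_inter_iff, Set.mem_preimage, Set.mem_Iic, Set.mem_Ici]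
    exact and_congr_left fun hu => tailInv_le_iff μ hu x
  rw [this, ← ofReal_cdf]
  refine le_antisymm ?_ ?_
  · calc _ ≤ volume (Set.Icc (1 - cdf μ x) 1) :=
          measure_mono fun u hu => ⟨hu.1, hu.2.2.le⟩
      _ = _ := by simp
  · calc _ = volume (Set.Ioo (1 - cdf μ x) 1) := by simp
      _ ≤ volume (Set.Ici (1 - cdf μ x) ∩ Set.Ioo 0 1) :=
          measure_mono fun u hu => ⟨hu.1.le, (sub_nonneg.2 h1).trans_lt hu.1, hu.2⟩

lemma intervalIntegrable_comp_tailInv {g : ℝ → ℝ} (hg : Integrable g μ) :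
    IntervalIntegrable (fun u => g (tailInv (cdf μ) u)) volume 0 1 := by
  rw [intervalIntegrable_iff_integrableOn_Ioo_of_le zero_le_one]
  have hg' := hg
  rw [← map_tailInv μ] at hg'
  exact hg'.comp_aemeasurable (aemeasurable_tailInv μ)

lemma integral_comp_tailInv {g : ℝ → ℝ} (hg : Integrable g μ) :
    ∫ u in (0 : ℝ)..1, g (tailInv (cdf μ) u) = ∫ x, g x ∂μ := by
  rw [intervalIntegral.integral_of_le zero_le_one, integral_Ioc_eq_integral_Ioo]
  have hg' := hg.aestronglyMeasurable
  rw [← map_tailInv μ] at hg'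
  rw [← integral_map (aemeasurable_tailInv μ) hg', map_tailInv]

end Quantile

/-! ### Weight sums as Riemann sums -/

section Weights

variable {μ : Measure ℝ} [IsProbabilityMeasure μ]

lemma weight_nonneg (hpos : ∀ᵐ x ∂μ, 0 ≤ x) {n : ℕ} (i : Fin n) : 0 ≤ weight (cdf μ) n i := by
  have hn : (0 : ℝ) < n := by exact_mod_cast i.pos
  refine tailInv_nonneg μ hpos ⟨by positivity, ?_⟩
  rw [div_le_one hn]
  exact_mod_cast i.2

lemma subinterval_subset {n k m : ℕ} (hkm : k ≤ m) (hm : m ≤ n) :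
    Set.uIcc ((k : ℝ) / n) ((m : ℝ) / n) ⊆ Set.uIcc 0 1 := by
  have hkm' : (k : ℝ) ≤ m := by exact_mod_cast hkm
  have hm' : (m : ℝ) ≤ n := by exact_mod_cast hm
  rw [Set.uIcc_of_le (by gcongr), Set.uIcc_of_le zero_le_one]
  exact Set.Icc_subset_Icc (by positivity) (div_le_one_of_le₀ hm' (by positivity))

lemma tailInv_le_of_le (hpos : ∀ᵐ x ∂μ, 0 ≤ x) {u v : ℝ} (hu : 0 < u) (huv : u ≤ v)
    (hv : v ≤ 1) : tailInv (cdf μ) v ≤ tailInv (cdf μ) u := by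
  rcases hv.eq_or_lt with rfl | hv
  · simpa [tailInv] using tailInv_nonneg μ hpos ⟨hu, huv⟩
  · exact tailInv_antitoneOn μ ⟨hu, huv.trans_lt hv⟩ ⟨hu.trans_le huv, hv⟩ huv

/-- A lower Riemann sum: each weight is the quantile at the right end of its cell, and the quantile
function decreases. -/
lemma sum_comp_weight_le (hpos : ∀ᵐ x ∂μ, 0 ≤ x) {g : ℝ → ℝ} (hg : Integrable g μ)
    (hmono : MonotoneOn g (Set.Ici 0)) {n : ℕ} (hn : 1 ≤ n) :
    (∑ i, g (weight (cdf μ) n i)) / n ≤ ∫ x, g x ∂μ := by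
  have hn' : (0 : ℝ) < n := by exact_mod_cast hn
  have hint := intervalIntegrable_comp_tailInv μ hg
  have hsum := intervalIntegral.sum_integral_adjacent_intervals (μ := volume)
    (f := fun u => g (tailInv (cdf μ) u)) (a := fun k : ℕ => (k : ℝ) / n) (n := n)
    fun k hk => hint.mono_set (subinterval_subset k.le_succ hk)
  simp only [Nat.cast_zero, zero_div, div_self hn'.ne'] at hsum
  rw [← integral_comp_tailInv μ hg, ← hsum, Finset.sum_div, ← Fin.sum_univ_eq_sum_range
    (fun k => ∫ u in (k : ℝ) / n..((k + 1 : ℕ) : ℝ) / n, g (tailInv (cdf μ) u)) n]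
  refine Finset.sum_le_sum fun i _ => ?_
  have hi : (i : ℕ) + 1 ≤ n := i.2
  have hi1 : ((i : ℕ) + 1 : ℝ) / n ≤ 1 := (div_le_one hn').2 (by exact_mod_cast hi)
  have hle : (i : ℝ) / n ≤ ((i + 1 : ℕ) : ℝ) / n := by gcongr; omega
  calc g (weight (cdf μ) n i) / n
      = ∫ _ in ((i : ℕ) : ℝ) / n..(((i : ℕ) + 1 : ℕ) : ℝ) / n, g (weight (cdf μ) n i) := by
        simp; ring
    _ ≤ _ := by
        refine intervalIntegral.integral_mono_on_of_le_Ioo hle (by simp)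
          (hint.mono_set (subinterval_subset (Nat.le_succ _) hi)) fun u hu => ?_
        have hu0 : 0 < u := lt_of_le_of_lt (by positivity) hu.1
        have hu1 : u ≤ ((i : ℕ) + 1 : ℝ) / n := by simpa using hu.2.le
        exact hmono (weight_nonneg hpos i) (tailInv_nonneg μ hpos ⟨hu0, hu1.trans hi1⟩)
          (tailInv_le_of_le hpos hu0 hu1 hi1)

/-- Each weight dominates the quantile on the next cell. This shift loses the cell `(0, 1/n)` and
leaves the last weight to be dropped. -/
lemma integral_tailInv_le_sum_weight (hpos : ∀ᵐ x ∂μ, 0 ≤ x) (hid : Integrable (fun x => x) μ)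
    {n : ℕ} (hn : 1 ≤ n) :
    ∫ u in (1 : ℝ) / n..1, tailInv (cdf μ) u ≤ (∑ i, weight (cdf μ) n i) / n := by
  have hn' : (0 : ℝ) < n := by exact_mod_cast hn
  have hint := intervalIntegrable_comp_tailInv μ hid
  have hsum := intervalIntegral.sum_integral_adjacent_intervals_Ico (μ := volume)
    (f := fun u => tailInv (cdf μ) u) (a := fun k : ℕ => (k : ℝ) / n) hn
    fun k hk => hint.mono_set (subinterval_subset k.le_succ hk.2)
  simp only [Nat.cast_one, div_self hn'.ne'] at hsum
  have hw : ∑ i, weight (cdf μ) n i =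
      ∑ k ∈ Finset.range n, tailInv (cdf μ) ((k + 1 : ℝ) / n) :=
    Fin.sum_univ_eq_sum_range (fun k => tailInv (cdf μ) ((k + 1 : ℝ) / n)) n
  obtain ⟨m, rfl⟩ : ∃ m, n = m + 1 := ⟨n - 1, by omega⟩
  rw [← hsum, hw, Finset.sum_Ico_eq_sum_range, Finset.sum_range_succ, Nat.add_sub_cancel,
    add_div, Finset.sum_div]
  refine le_add_of_le_of_nonneg (Finset.sum_le_sum fun k hk => ?_) ?_
  · have hk : k + 2 ≤ m + 1 := by have := Finset.mem_range.1 hk; omega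
    have hk' : (k : ℝ) + 2 ≤ (m + 1 : ℕ) := by exact_mod_cast hk
    have hle : ((1 + k : ℕ) : ℝ) / (m + 1 : ℕ) ≤ ((1 + k + 1 : ℕ) : ℝ) / (m + 1 : ℕ) := by
      exact div_le_div_of_nonneg_right (by push_cast; linarith) hn'.le
    calc _ ≤ ∫ _ in ((1 + k : ℕ) : ℝ) / (m + 1 : ℕ)..((1 + k + 1 : ℕ) : ℝ) / (m + 1 : ℕ),
          tailInv (cdf μ) ((k + 1 : ℝ) / (m + 1 : ℕ)) := by
          refine intervalIntegral.integral_mono_on_of_le_Ioo hle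
            (hint.mono_set (subinterval_subset (Nat.le_succ _) (by omega))) (by simp) fun u hu => ?_
          have hu1 : u ≤ 1 := hu.2.le.trans ((div_le_one hn').2 (by push_cast at hk' ⊢; linarith))
          refine tailInv_le_of_le hpos (by positivity) ?_ hu1
          have := hu.1.le
          push_cast at this ⊢
          rwa [add_comm (k : ℝ) 1]
      _ = _ := by
          rw [intervalIntegral.integral_const, smul_eq_mul, ← sub_div]
          push_cast
          ring
  · refine div_nonneg (tailInv_nonneg μ hpos ⟨by positivity, ?_⟩) hn'.le
    rw [div_le_one hn']
    push_cast
    exact le_rfl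

/-- Integrate `x ≤ x² / (2√n) + √n / 2` over an interval of length `1/n`. -/
lemma integral_tailInv_le (hid : Integrable (fun x => x) μ)
    (hsq : Integrable (fun x => x ^ 2) μ) {n : ℕ} (hn : 1 ≤ n) :
    ∫ u in (0 : ℝ)..(1 : ℝ) / n, tailInv (cdf μ) u ≤ ((∫ x, x ^ 2 ∂μ) + 1) / 2 / √n := by
  have hn' : (0 : ℝ) < n := by exact_mod_cast hn
  have hs : 0 < √(n : ℝ) := Real.sqrt_pos.2 hn'
  have hss : √(n : ℝ) ^ 2 = n := Real.sq_sqrt hn'.le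
  have hsub : Set.uIcc (0 : ℝ) (1 / n) ⊆ Set.uIcc 0 1 := by
    simpa using subinterval_subset (n := n) (k := 0) (m := 1) zero_le_one hn
  have h1n : (1 : ℝ) / n ≤ 1 := (div_le_one hn').2 (by exact_mod_cast hn)
  have hint := (intervalIntegrable_comp_tailInv μ hid).mono_set hsub
  have hintsq := intervalIntegrable_comp_tailInv μ hsq
  have hintsq' := (hintsq.mono_set hsub).const_mul (2 * √(n : ℝ))⁻¹
  calc ∫ u in (0 : ℝ)..(1 : ℝ) / n, tailInv (cdf μ) u
      ≤ ∫ u in (0 : ℝ)..(1 : ℝ) / n, ((2 * √n)⁻¹ * tailInv (cdf μ) u ^ 2 + √n / 2) := by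
        refine intervalIntegral.integral_mono_on (by positivity) hint
          (hintsq'.add (by simp)) fun u _ => ?_
        have := sq_nonneg (tailInv (cdf μ) u - √n)
        rw [inv_mul_eq_div, ← sub_nonneg]
        have h2 : tailInv (cdf μ) u ^ 2 / (2 * √n) + √n / 2 - tailInv (cdf μ) u =
            (tailInv (cdf μ) u - √n) ^ 2 / (2 * √n) := by
          field_simp
          ring
        rw [h2]
        positivity
    _ = (2 * √n)⁻¹ * (∫ u in (0 : ℝ)..(1 : ℝ) / n, tailInv (cdf μ) u ^ 2) + 1 / (2 * √n) := by
        rw [intervalIntegral.integral_add hintsq' (by simp), intervalIntegral.integral_const_mul,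
          intervalIntegral.integral_const]
        congr 1
        simp only [smul_eq_mul, sub_zero]
        field_simp
        exact hss
    _ ≤ (2 * √n)⁻¹ * (∫ x, x ^ 2 ∂μ) + 1 / (2 * √n) := by
        gcongr
        rw [← integral_comp_tailInv μ hsq]
        exact intervalIntegral.integral_mono_interval le_rfl (by positivity) h1n
          (.of_forall fun u => sq_nonneg _) hintsq
    _ = _ := by
        field_simp

lemma sub_le_sum_weight (hpos : ∀ᵐ x ∂μ, 0 ≤ x) (hid : Integrable (fun x => x) μ)
    (hsq : Integrable (fun x => x ^ 2) μ) {n : ℕ} (hn : 1 ≤ n) :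
    (∫ x, x ∂μ) - ((∫ x, x ^ 2 ∂μ) + 1) / 2 / √n ≤ (∑ i, weight (cdf μ) n i) / n := by
  have hsub : Set.uIcc (0 : ℝ) (1 / n) ⊆ Set.uIcc 0 1 := by
    simpa using subinterval_subset (n := n) (k := 0) (m := 1) zero_le_one hn
  have hsub' : Set.uIcc ((1 : ℝ) / n) 1 ⊆ Set.uIcc 0 1 := by
    have hn' : (n : ℝ) ≠ 0 := by positivity
    simpa [hn'] using subinterval_subset (n := n) hn le_rfl
  have hint := intervalIntegrable_comp_tailInv μ hid
  have h1 := intervalIntegral.integral_add_adjacent_intervals (hint.mono_set hsub)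
    (hint.mono_set hsub')
  rw [integral_comp_tailInv μ hid] at h1
  have h2 := integral_tailInv_le_sum_weight hpos hid hn
  have h3 := integral_tailInv_le hid hsq hn
  linarith

end Weights

end NorrosReittu

/-! ### Choice of constants and conclusion -/

/-- Undefined integrals and division by zero both give `0`, so a ratio of `1` forces finite moments.
-/
lemma NorrosReittu.integrable_of_nu_eq_one {μ : Measure ℝ} (hν : NorrosReittu.nu μ = 1) :
    Integrable (fun x => x) μ ∧ Integrable (fun x => x ^ 2) μ ∧
      (∫ x, x ∂μ) ≠ 0 ∧ ∫ x, x ^ 2 ∂μ = ∫ x, x ∂μ := by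
  rw [NorrosReittu.nu] at hν
  have h1 : (∫ x, x ∂μ) ≠ 0 := fun h => by simp [h] at hν
  have h2 : (∫ x, x ^ 2 ∂μ) = ∫ x, x ∂μ := (div_eq_one_iff_eq h1).1 hν
  exact ⟨not_imp_comm.1 integral_undef h1, not_imp_comm.1 integral_undef (h2 ▸ h1), h1, h2⟩

theorem proposition2p5 (μ : Measure ℝ) [IsProbabilityMeasure μ]
    (hpos : ∀ᵐ x ∂μ, 0 ≤ x) (hν : NorrosReittu.nu μ = 1) (τ δ : ℝ)
    (hδ : δ = min τ 4 - 2)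
    (hτ : (4 < τ ∧ ∃ c : ℝ, 0 < c ∧ ∀ᶠ x : ℝ in atTop, 1 - cdf μ x ≤ c * x ^ (-(τ - 1))) ∨
      (3 < τ ∧ τ < 4 ∧ ∃ c : ℝ, 0 < c ∧
        Tendsto (fun x : ℝ => x ^ (τ - 1) * (1 - cdf μ x)) atTop (𝓝 c))) :
    ∃ Λ₀ : ℝ, 1 ≤ Λ₀ ∧ ∀ Λ : ℝ, Λ₀ ≤ Λ → ∀ n : ℕ, 1 ≤ n → ∀ ε : ℝ, -1 ≤ ε →
      ε ≤ -Λ * (n : ℝ) ^ (-((δ - 1) / (δ + 1))) →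
      NorrosReittu.expectedClusterSize (NorrosReittu.scaledWeight (cdf μ) ε n) ≤
        (n : ℝ) ^ ((δ - 1) / (δ + 1)) := by
  obtain ⟨hid, hsq, hm0, hm2⟩ := NorrosReittu.integrable_of_nu_eq_one hν
  set m := ∫ x, x ∂μ with hm
  have hmpos : 0 < m := (integral_nonneg_of_ae hpos).lt_of_ne' hm0
  set a := (δ - 1) / (δ + 1) with ha
  have hδ1 : 1 < δ := by
    have : 3 < min τ 4 := lt_min (by rcases hτ with h | h <;> linarith [h.1]) (by norm_num)
    linarith
  have ha2 : a ≤ 1 / 2 := by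
    have : min τ 4 ≤ 4 := min_le_right _ _
    rw [ha, div_le_div_iff₀ (by linarith) (by norm_num)]
    linarith
  -- `K / √n` bounds the relative deficit of the mean weight.
  set K := (m + 1) / 2 / m with hK
  have hKpos : 0 < K := by positivity
  refine ⟨2 + K + 2 * m, by linarith, fun Λ hΛ n hn ε hε hεΛ => ?_⟩
  have hn1 : (1 : ℝ) ≤ n := by exact_mod_cast hn
  have hn' : (0 : ℝ) < n := by linarith
  set s := (n : ℝ) ^ (-a) with hs
  have hspos : 0 < s := by positivity
  have hsinv : (n : ℝ) ^ a = 1 / s := by rw [hs, Real.rpow_neg hn'.le, one_div, inv_inv]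
  have hsqrt : 1 / √(n : ℝ) ≤ s := by
    rw [hs, Real.sqrt_eq_rpow, one_div, ← Real.rpow_neg hn'.le]
    exact Real.rpow_le_rpow_of_exponent_le hn1 (by linarith)
  -- From `-1 ≤ ε ≤ -Λ s`; for small `n` no such `ε` exists. With `2 ≤ Λ` this gives `s ≤ 1/2`, used
  -- at the end.
  have hΛs : Λ * s ≤ 1 := by linarith
  have hΛK : 2 * m ≤ Λ - K := by linarith
  have hw := fun i => NorrosReittu.weight_nonneg hpos (n := n) i
  have hθ : 0 ≤ 1 + ε := by linarith
  have hsum2 : (∑ i, NorrosReittu.weight (cdf μ) n i ^ 2) ≤ m * n := by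
    rw [← div_le_iff₀ hn', ← hm2]
    exact NorrosReittu.sum_comp_weight_le hpos hsq
      (fun x hx y _ hxy => pow_le_pow_left₀ hx hxy 2) hn
  have hsum1 : (∑ i, NorrosReittu.weight (cdf μ) n i) / n ≤ m :=
    NorrosReittu.sum_comp_weight_le hpos hid (fun _ _ _ _ h => h) hn
  have hsum1' : m * (1 - K * s) * n ≤ ∑ i, NorrosReittu.weight (cdf μ) n i := by
    rw [← le_div_iff₀ hn']
    refine le_trans ?_ (NorrosReittu.sub_le_sum_weight hpos hid hsq hn)
    rw [hm2, ← hm]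
    have hKm : (m + 1) / 2 = K * m := by rw [hK]; field_simp
    have : (m + 1) / 2 / √(n : ℝ) = K * m * (1 / √(n : ℝ)) := by rw [hKm]; ring
    rw [this]
    have := mul_le_mul_of_nonneg_left hsqrt (show 0 ≤ K * m by positivity)
    linarith
  set ρ := 1 - (Λ - K) * s with hρ
  have hgap : 0 < (Λ - K) * s := mul_pos (by linarith) hspos
  have hKs : 0 ≤ K * s := by positivity
  have hρ0 : 0 ≤ ρ := by linarith
  have hcrit : ∑ i, NorrosReittu.scaledWeight (cdf μ) ε n i ^ 2 ≤
      ρ * ∑ i, NorrosReittu.scaledWeight (cdf μ) ε n i := by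
    simp only [NorrosReittu.scaledWeight, mul_pow, ← Finset.mul_sum]
    -- The right side expands to `1 - Λ s + K s (Λ - K) s`.
    have h1 : 1 + ε ≤ ρ * (1 - K * s) := by
      have := mul_nonneg hKs hgap.le
      rw [hρ]
      linarith
    calc (1 + ε) ^ 2 * ∑ i, NorrosReittu.weight (cdf μ) n i ^ 2
        ≤ (1 + ε) ^ 2 * (m * n) := by gcongr
      _ = (1 + ε) * (m * n) * (1 + ε) := by ring
      _ ≤ (1 + ε) * (m * n) * (ρ * (1 - K * s)) := by gcongr
      _ = ρ * ((1 + ε) * (m * (1 - K * s) * n)) := by ring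
      _ ≤ _ := by gcongr
  refine (NorrosReittu.expectedClusterSize_le hn (fun i => mul_nonneg hθ (hw i))
    (by linarith : ρ < 1) hcrit).trans ?_
  simp only [← Finset.mul_sum]
  have hmean : (1 + ε) * (∑ i, NorrosReittu.weight (cdf μ) n i) / n ≤ m := by
    rw [mul_div_assoc]
    have h0 : 0 ≤ (∑ i, NorrosReittu.weight (cdf μ) n i) / n :=
      div_nonneg (Finset.sum_nonneg fun i _ => hw i) hn'.le
    have hΛs0 : 0 ≤ Λ * s := mul_nonneg (by linarith) hspos.le
    exact (mul_le_of_le_one_left h0 (by linarith)).trans hsum1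
  have h1ρ : 1 - ρ = (Λ - K) * s := by rw [hρ]; ring
  rw [h1ρ, hsinv, le_div_iff₀ hspos]
  calc (1 + (1 + ε) * (∑ i, NorrosReittu.weight (cdf μ) n i) / n / ((Λ - K) * s)) * s
      ≤ (1 + m / (2 * m * s)) * s := by gcongr
    _ = s + 1 / 2 := by field_simp
    _ ≤ 1 := by
      have := mul_le_mul_of_nonneg_right (show 2 ≤ Λ by linarith) hspos.le
      linarith
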